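/- Let $G$ be a totally disconnected, locally compact group and let $\alpha : G \to G$ be a continuous endomorphism. Write $\mathbb{N}=\{0,1,2,\dots\}$. For a compact open subgroup $U \le G$ and $n\in\mathbb{N}$ put $$U_+ = \{x\in U \mid \exists (x_k)_{k\in\mathbb{N}}\subseteq U \text{ with } x_0 = x \text{ and } \alpha(x_{k+1}) = x_k \text{ for all } k\},$$ $$U_{-n} = \bigcap_{k=0}^{n}\alpha^{-k}(U),\qquad U_- = \bigcap_{n\ge 0} U_{-n} = \{x\in U\mid \alpha^k(x)\in U \text{ for all } k\in\mathbb{N}\},$$ where $\alpha^{-k}(U)$ is the preimage of $U$ under $\alpha^k$. The compact open subgroup $U$ is called tidy for $\alpha$ if $U = U_+U_-$, the subgroup $U_{++} = \bigcup_{n\ge 0}\alpha^n(U_+)$ is closed in $G$, and the sequence of indices $[\alpha^{n+1}(U_+):\alpha^n(U_+)]$, $n\in\mathbb{N}$, is constant. Let $W$ be a compact open subgroup of $G$ that is tidy for $\alpha$. Then: 1. $W_{-n}$ is tidy for $\alpha$ for every $n\in\mathbb{N}$. 2. For every subgroup $V$ of $W_-$ that is open in $W_-$ (in the subspace topology) and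 contains $W_+\cap W_-$, there is an open subgroup $\hat W$ of $W$ that is tidy for $\alpha$, contains $W_+$, and satisfies $\hat W\cap W_-\le V$. 3. $$W_+\cap W_- = \bigcap\{\hat W \mid W_+\cap W_-\le \hat W\le W \text{ and } \hat W \text{ is tidy for } \alpha\}.$$ -/

import Mathlib

open scoped Pointwise

namespace TidyEndo

variable {G : Type*} [Group G] [TopologicalSpace G]

/-- A continuous endomorphism as an element of the monoid of endomorphisms under composition. -/
def toEnd (α : G →ₜ* G) : Monoid.End G := α.toMonoidHom

/-- The iterate `αⁿ` of a continuous endomorphism, as a group homomorphism. -/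
def iter (α : G →ₜ* G) (n : ℕ) : G →* G := toEnd α ^ n

theorem iter_apply (α : G →ₜ* G) (n : ℕ) (x : G) : iter α n x = α^[n] x :=
  congrFun (Monoid.End.coe_pow G (toEnd α) n) x

/-- `U₊`: the elements of `U` that have an `α`-regressive sequence lying in `U`. -/
def plus (α : G →ₜ* G) (U : Subgroup G) : Subgroup G where
  carrier := {x | x ∈ U ∧ ∃ s : ℕ → G, (∀ n, s n ∈ U) ∧ s 0 = x ∧ ∀ n, α (s (n + 1)) = s n}
  mul_mem' := by
    rintro x y ⟨hx, s, hs, hs0, hsα⟩ ⟨hy, t, ht, ht0, htα⟩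
    exact ⟨U.mul_mem hx hy, fun n => s n * t n, fun n => U.mul_mem (hs n) (ht n),
      by simp [hs0, ht0], fun n => by simp [hsα, htα]⟩
  one_mem' := ⟨U.one_mem, fun _ => 1, fun _ => U.one_mem, rfl, fun _ => map_one α⟩
  inv_mem' := by
    rintro x ⟨hx, s, hs, hs0, hsα⟩
    exact ⟨U.inv_mem hx, fun n => (s n)⁻¹, fun n => U.inv_mem (hs n),
      by simp [hs0], fun n => by simp [hsα]⟩

/-- `U₋ₙ = ⋂_{0 ≤ k ≤ n} α⁻ᵏ(U)`. -/
def minusN (α : G →ₜ* G) (U : Subgroup G) (n : ℕ) : Subgroup G :=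
  ⨅ k ∈ Set.Iic n, U.comap (iter α k)

/-- `U₋ = ⋂_{n ≥ 0} U₋ₙ`. -/
def minus (α : G →ₜ* G) (U : Subgroup G) : Subgroup G :=
  ⨅ n : ℕ, minusN α U n

theorem mem_minusN {α : G →ₜ* G} {U : Subgroup G} {n : ℕ} {x : G} :
    x ∈ minusN α U n ↔ ∀ k ≤ n, α^[k] x ∈ U := by
  simp [minusN, Subgroup.mem_iInf, iter_apply]

theorem mem_minus {α : G →ₜ* G} {U : Subgroup G} {x : G} :
    x ∈ minus α U ↔ ∀ n : ℕ, α^[n] x ∈ U := by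
  simp only [minus, Subgroup.mem_iInf, mem_minusN]
  exact ⟨fun h n => h n n le_rfl, fun h _ k _ => h k⟩

/-- `U₊₊ = ⋃_{n ≥ 0} αⁿ(U₊)`, as a subset of `G`. -/
def plusPlus (α : G →ₜ* G) (U : Subgroup G) : Set G :=
  ⋃ n : ℕ, ((plus α U).map (iter α n) : Set G)

/-- Condition TA: `U = U₊U₋`. -/
def IsTidyAbove (α : G →ₜ* G) (U : Subgroup G) : Prop :=
  (U : Set G) = (plus α U : Set G) * (minus α U : Set G)

/-- Conditions TB1 and TB2: `U₊₊` is closed, and the sequence of indices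
`[αⁿ⁺¹(U₊) : αⁿ(U₊)]` is constant. -/
def IsTidyBelow (α : G →ₜ* G) (U : Subgroup G) : Prop :=
  IsClosed (plusPlus α U) ∧
    ∃ c : ℕ, ∀ n : ℕ,
      ((plus α U).map (iter α n)).relIndex ((plus α U).map (iter α (n + 1))) = c

/-- `U` is a compact open subgroup that is tidy for `α`. -/
structure IsTidy (α : G →ₜ* G) (U : Subgroup G) : Prop where
  isCompact : IsCompact (U : Set G)
  isOpen : IsOpen (U : Set G)
  tidyAbove : IsTidyAbove α U
  tidyBelow : IsTidyBelow α U

end TidyEndo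

/-!
`U₊` is the largest subgroup `H ≤ U` with `H ≤ α(H)`, and `U₋` is the largest one with `α(H) ≤ H`.

For part 1, `(U₋ₙ)₋ = U₋` and `(U₋ₙ)₊ = U₊ ∩ U₋ₙ`, so `U = U₊U₋` cuts down to `U₋ₙ`; and
`α((U₋₁)₊) = U₊`, so passing from `U` to `U₋₁` only shifts the groups `αⁿ(U₊)` by one.

For part 2, compactness gives `⋂ αⁿ(W₋) ≤ W₊ ∩ W₋ ≤ V`, hence `αⁿ(W₋) ≤ V` for large `n`, so
`V₋` is cut out of `W₋` by finitely many of the conditions `αᵏ(x) ∈ V` and is relatively open. Then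
`W₊V₋` is compact and open, being the complement in `W = W₊W₋` of the compact set `W₊(W₋ \ V₋)`.
Its left stabilizer `Ŵ` is an open subgroup with `W₊ ≤ Ŵ ⊆ W₊V₋`, so `Ŵ₊ = W₊` and tidiness below
is inherited; tidiness above holds because `α` maps `Ŵ ∩ W₋` into itself.

Part 3 follows: the intersection lies in every `W₋ₙ` by part 1, hence in `W₋`, and the closed
subgroup `W₊ ∩ W₋` of the profinite group `W₋` is an intersection of open subgroups `V` as in
part 2.
-/

namespace TidyEndo

section Group

variable {G : Type*} [Group G]

theorem mem_stabilizer_iff_smul_subset {X : Type*} [MulAction G X] {S : Set X} {x : G} :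
    x ∈ MulAction.stabilizer G S ↔ x • S ⊆ S ∧ x⁻¹ • S ⊆ S := by
  rw [MulAction.mem_stabilizer_iff, Set.Subset.antisymm_iff, Set.subset_smul_set_iff]

theorem stabilizer_subset_of_one_mem {S : Set G} (hS : 1 ∈ S) :
    (MulAction.stabilizer G S : Set G) ⊆ S := fun x hx => by
  simpa using (MulAction.mem_stabilizer_set.1 hx 1).2 hS

theorem mul_eq_mul_sdiff_mul_sdiff {A B P : Subgroup G} (hPB : P ≤ B) (hAB : A ⊓ B ≤ P) :
    (A : Set G) * P = (A * B : Set G) \ (A * ((B : Set G) \ (P : Set G))) := by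
  ext x
  constructor
  · rintro ⟨a, ha, p, hp, rfl⟩
    refine ⟨Set.mul_mem_mul ha (hPB hp), ?_⟩
    rintro ⟨a', ha', b, ⟨hb, hbP⟩, h : a' * b = a * p⟩
    have hbp : b * p⁻¹ = a'⁻¹ * a := by
      rw [mul_inv_eq_iff_eq_mul, mul_assoc, ← h, inv_mul_cancel_left]
    have hbp_mem : b * p⁻¹ ∈ A ⊓ B :=
      ⟨hbp ▸ A.mul_mem (A.inv_mem ha') ha, B.mul_mem hb (B.inv_mem (hPB hp))⟩
    exact hbP ((P.mul_mem_cancel_right (P.inv_mem hp)).1 (hAB hbp_mem))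
  · rintro ⟨⟨a, ha, b, hb, rfl⟩, hab⟩
    exact Set.mul_mem_mul ha (by_contra fun hbP => hab (Set.mul_mem_mul ha ⟨hb, hbP⟩))

variable [TopologicalSpace G] [IsTopologicalGroup G]

theorem isOpen_stabilizer {S : Set G} (hSc : IsCompact S) (hSo : IsOpen S) :
    IsOpen (MulAction.stabilizer G S : Set G) := by
  obtain ⟨N, hN, hNS⟩ := compact_open_separated_mul_left hSc hSo subset_rfl
  refine Subgroup.isOpen_of_mem_nhds _ (g := 1)
    (Filter.mem_of_superset (Filter.inter_mem hN (inv_mem_nhds_one G hN)) ?_)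
  rintro x ⟨hx, hx'⟩
  exact mem_stabilizer_iff_smul_subset.2
    ⟨(Set.smul_set_subset_mul hx).trans hNS,
      (Set.smul_set_subset_mul (Set.mem_inv.1 hx')).trans hNS⟩

variable {A B P : Subgroup G}

theorem isCompact_of_isOpen_subgroupOf (hB : IsCompact (B : Set G)) (hPB : P ≤ B)
    (hP : IsOpen (P.subgroupOf B : Set B)) : IsCompact (P : Set G) := by
  have : CompactSpace B := isCompact_iff_compactSpace.1 hB
  rw [← Subgroup.map_subgroupOf_eq_of_le hPB]
  exact (Subgroup.isClosed_of_isOpen _ hP).isCompact.image continuous_subtype_val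

theorem isOpen_mul_of_isOpen_subgroupOf [T2Space G] (hA : IsCompact (A : Set G))
    (hB : IsCompact (B : Set G)) (hABo : IsOpen (A * B : Set G)) (hPB : P ≤ B)
    (hP : IsOpen (P.subgroupOf B : Set B)) (hAB : A ⊓ B ≤ P) : IsOpen (A * P : Set G) := by
  obtain ⟨O, hO, hOP⟩ := isOpen_induced_iff.1 hP
  have hsdiff : (B : Set G) \ (P : Set G) = (B : Set G) \ O := by
    ext x
    exact and_congr_right fun hx => not_congr (Set.ext_iff.1 hOP ⟨x, hx⟩).symm
  rw [mul_eq_mul_sdiff_mul_sdiff hPB hAB, hsdiff]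
  exact hABo.sdiff (hA.mul (hB.diff hO)).isClosed

theorem mem_of_forall_isOpen_subgroupOf [TotallyDisconnectedSpace G] {H K : Subgroup G}
    (hH : IsCompact (H : Set G)) (hK : IsClosed (K : Set G)) {x : G} (hx : x ∈ H)
    (hxV : ∀ V ≤ H, IsOpen (V.subgroupOf H : Set H) → K ⊓ H ≤ V → x ∈ V) : x ∈ K := by
  have : CompactSpace H := isCompact_iff_compactSpace.1 hH
  let K' : ClosedSubgroup H := ⟨K.subgroupOf H, hK.preimage continuous_subtype_val⟩
  suffices (⟨x, hx⟩ : H) ∈ (K' : Subgroup H) from this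
  rw [ProfiniteGrp.closedSubgroup_eq_sInf_open K', Subgroup.mem_sInf]
  rintro V ⟨hV, hKV⟩
  have hsub : (V.map H.subtype).subgroupOf H = V :=
    Subgroup.comap_map_eq_self_of_injective H.subtype_injective V
  have hxmap : x ∈ V.map H.subtype := hxV _ (Subgroup.map_subtype_le V) (hsub.symm ▸ hV)
    fun y hy => ⟨⟨y, hy.2⟩, hKV hy.1, rfl⟩
  exact hsub ▸ (show (⟨x, hx⟩ : H) ∈ (V.map H.subtype).subgroupOf H from hxmap)

end Group

variable {G : Type*} [Group G] [TopologicalSpace G] {α : G →ₜ* G} {H U V W : Subgroup G}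

theorem map_iter_zero (H : Subgroup G) : H.map (iter α 0) = H := Subgroup.map_id H

theorem map_iter_succ (H : Subgroup G) (n : ℕ) :
    H.map (iter α (n + 1)) = (H.map (α : G →* G)).map (iter α n) := by
  rw [Subgroup.map_map, iter, pow_succ]
  rfl

theorem map_iter_succ' (H : Subgroup G) (n : ℕ) :
    H.map (iter α (n + 1)) = (H.map (iter α n)).map (α : G →* G) := by
  rw [Subgroup.map_map, iter, pow_succ']
  rfl

theorem plus_le : plus α U ≤ U := fun _ hx => hx.1

theorem plus_le_map_plus : plus α U ≤ (plus α U).map (α : G →* G) := by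
  rintro _ ⟨-, s, hs, rfl, hα⟩
  exact ⟨s 1, ⟨hs 1, fun n => s (n + 1), fun n => hs (n + 1), rfl, fun n => hα (n + 1)⟩, hα 0⟩

theorem le_plus_of_le_map (hHU : H ≤ U) (hH : H ≤ H.map (α : G →* G)) : H ≤ plus α U := by
  intro x hx
  choose g hg hαg using fun y : H => hH y.2
  let s : ℕ → H := fun n => (fun y => ⟨g y, hg y⟩)^[n] ⟨x, hx⟩
  refine ⟨hHU hx, fun n => s n, fun n => hHU (s n).2, rfl, fun n => ?_⟩
  simp only [s, Function.iterate_succ_apply']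
  exact hαg _

theorem plus_mono (hUW : U ≤ W) : plus α U ≤ plus α W :=
  le_plus_of_le_map (plus_le.trans hUW) plus_le_map_plus

theorem plus_eq_of_le (hUW : U ≤ W) (hWU : plus α W ≤ U) : plus α U = plus α W :=
  (plus_mono hUW).antisymm (le_plus_of_le_map hWU plus_le_map_plus)

theorem map_mem_plus {x : G} (hx : x ∈ plus α U) (hxU : α x ∈ U) : α x ∈ plus α U := by
  obtain ⟨-, s, hs, rfl, hα⟩ := hx
  refine ⟨hxU, fun n => Nat.casesOn n (α (s 0)) s, ?_, rfl, ?_⟩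
  · rintro (_ | n)
    exacts [hxU, hs n]
  · rintro (_ | n)
    exacts [rfl, hα n]

theorem minus_le : minus α U ≤ U := fun _ hx => mem_minus.1 hx 0

theorem map_mem_minus {x : G} (hx : x ∈ minus α U) : α x ∈ minus α U :=
  mem_minus.2 fun n => mem_minus.1 hx (n + 1)

theorem map_minus_le : (minus α U).map (α : G →* G) ≤ minus α U :=
  Subgroup.map_le_iff_le_comap.2 fun _ hx => map_mem_minus hx

theorem iterate_mem_of_map_le (hH : H.map (α : G →* G) ≤ H) {x : G} (hx : x ∈ H) (n : ℕ) :
    α^[n] x ∈ H :=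
  Set.MapsTo.iterate (fun _ hy => hH (Subgroup.mem_map_of_mem _ hy)) n hx

theorem le_minus_of_map_le (hHU : H ≤ U) (hH : H.map (α : G →* G) ≤ H) : H ≤ minus α U :=
  fun _ hx => mem_minus.2 fun n => hHU (iterate_mem_of_map_le hH hx n)

theorem map_plus_inf_minus_le :
    (plus α U ⊓ minus α U).map (α : G →* G) ≤ plus α U ⊓ minus α U := by
  rintro _ ⟨x, ⟨hxp, hxm⟩, rfl⟩
  exact ⟨map_mem_plus hxp (minus_le (map_mem_minus hxm)), map_mem_minus hxm⟩

theorem antitone_map_iter_minus : Antitone fun n => (minus α U).map (iter α n) :=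
  antitone_nat_of_succ_le fun n => by
    rw [map_iter_succ]
    exact Subgroup.map_mono map_minus_le

theorem minusN_le (n : ℕ) : minusN α U n ≤ U := fun _ hx => mem_minusN.1 hx 0 n.zero_le

theorem minus_le_minusN (n : ℕ) : minus α U ≤ minusN α U n := iInf_le _ n

theorem minusN_zero : minusN α U 0 = U := by
  ext x
  simp [mem_minusN]

theorem minusN_one : minusN α U 1 = U ⊓ U.comap (α : G →* G) := by
  ext x
  simp [mem_minusN, Nat.le_one_iff_eq_zero_or_eq_one, Subgroup.mem_inf]

theorem minusN_minusN_one (n : ℕ) : minusN α (minusN α U n) 1 = minusN α U (n + 1) := by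
  ext x
  simp only [minusN_one, Subgroup.mem_inf, Subgroup.mem_comap, mem_minusN]
  constructor
  · rintro ⟨h₀, h₁⟩ (_ | k) hk
    exacts [h₀ 0 n.zero_le, h₁ k (by omega)]
  · exact fun h => ⟨fun k hk => h k (by omega), fun k hk => h (k + 1) (by omega)⟩

theorem minus_minusN (n : ℕ) : minus α (minusN α U n) = minus α U :=
  le_antisymm (le_minus_of_map_le (minus_le.trans (minusN_le n)) map_minus_le)
    (le_minus_of_map_le (minus_le_minusN n) map_minus_le)

theorem plus_minusN (n : ℕ) : plus α (minusN α U n) = plus α U ⊓ minusN α U n := by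
  refine le_antisymm (le_inf (plus_mono (minusN_le n)) plus_le) ?_
  refine le_plus_of_le_map inf_le_right fun x hx => ?_
  obtain ⟨y, hy, rfl⟩ := plus_le_map_plus hx.1
  refine ⟨y, ⟨hy, mem_minusN.2 ?_⟩, rfl⟩
  rintro (_ | k) hk
  exacts [plus_le hy, mem_minusN.1 hx.2 k (by omega)]

theorem plus_minusN_one : plus α (minusN α U 1) = plus α U ⊓ (plus α U).comap (α : G →* G) := by
  rw [plus_minusN, minusN_one, ← inf_assoc, inf_eq_left.2 plus_le]
  ext x
  exact and_congr_right fun hx => ⟨map_mem_plus hx, @plus_le _ _ _ α U (α x)⟩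

theorem map_plus_minusN_one : (plus α (minusN α U 1)).map (α : G →* G) = plus α U := by
  rw [plus_minusN_one]
  refine le_antisymm (Subgroup.map_le_iff_le_comap.2 inf_le_right) fun x hx => ?_
  obtain ⟨y, hy, rfl⟩ := plus_le_map_plus hx
  exact ⟨y, ⟨hy, hx⟩, rfl⟩

theorem map_iter_succ_plus_minusN_one (n : ℕ) :
    (plus α (minusN α U 1)).map (iter α (n + 1)) = (plus α U).map (iter α n) := by
  rw [map_iter_succ, map_plus_minusN_one]

theorem plusPlus_minusN_one : plusPlus α (minusN α U 1) = plusPlus α U := by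
  refine Set.Subset.antisymm ?_ (Set.iUnion_subset fun n => ?_)
  · exact Set.iUnion_mono fun n => Subgroup.map_mono (plus_mono (minusN_le 1))
  · rw [← map_iter_succ_plus_minusN_one]
    exact Set.subset_iUnion (fun k => ((plus α (minusN α U 1)).map (iter α k) : Set G)) (n + 1)

theorem relIndex_plus_minusN_one :
    (plus α (minusN α U 1)).relIndex (plus α U) =
      (plus α U).relIndex ((plus α U).map (α : G →* G)) := by
  rw [plus_minusN_one, inf_comm, Subgroup.inf_relIndex_right, Subgroup.relIndex_comap]

theorem IsTidyBelow.minusN_one (h : IsTidyBelow α U) : IsTidyBelow α (minusN α U 1) := by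
  obtain ⟨hclosed, c, hc⟩ := h
  refine ⟨by rwa [plusPlus_minusN_one], c, ?_⟩
  rintro (_ | n)
  · have hc₀ := hc 0
    rw [map_iter_succ, map_iter_zero, map_iter_zero] at hc₀
    rw [map_iter_succ_plus_minusN_one, map_iter_zero, map_iter_zero, relIndex_plus_minusN_one, hc₀]
  · simpa only [map_iter_succ_plus_minusN_one] using hc n

theorem IsTidyBelow.minusN (h : IsTidyBelow α U) (n : ℕ) : IsTidyBelow α (minusN α U n) := by
  induction n with
  | zero => rwa [minusN_zero]
  | succ n ih => exact minusN_minusN_one (α := α) (U := U) n ▸ ih.minusN_one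

theorem IsTidyBelow.of_plus_eq (h : IsTidyBelow α W) (hUW : plus α U = plus α W) :
    IsTidyBelow α U := by
  simpa only [IsTidyBelow, plusPlus, hUW] using h

theorem isTidyAbove_iff_subset :
    IsTidyAbove α U ↔ (U : Set G) ⊆ (plus α U : Set G) * (minus α U : Set G) := by
  refine ⟨fun h => h.subset, fun h => h.antisymm ?_⟩
  rintro _ ⟨y, hy, z, hz, rfl⟩
  exact U.mul_mem (plus_le hy) (minus_le hz)

theorem IsTidyAbove.minusN (h : IsTidyAbove α U) (n : ℕ) : IsTidyAbove α (minusN α U n) := by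
  refine isTidyAbove_iff_subset.2 fun x hx => ?_
  obtain ⟨y, hy, z, hz, rfl⟩ := h.subset (minusN_le n hx)
  rw [plus_minusN, minus_minusN]
  have hyn : y ∈ TidyEndo.minusN α U n :=
    (Subgroup.mul_mem_cancel_right _ (minus_le_minusN n hz)).1 hx
  exact Set.mul_mem_mul ⟨hy, hyn⟩ hz

theorem IsTidyAbove.of_plus_le (h : IsTidyAbove α W) (hUW : U ≤ W) (hWU : plus α W ≤ U)
    (hα : (U ⊓ minus α W).map (α : G →* G) ≤ U) : IsTidyAbove α U := by
  have hinv : (U ⊓ minus α W).map (α : G →* G) ≤ U ⊓ minus α W :=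
    le_inf hα ((Subgroup.map_mono inf_le_right).trans map_minus_le)
  refine isTidyAbove_iff_subset.2 fun x hx => ?_
  obtain ⟨y, hy, z, hz, rfl⟩ := h.subset (hUW hx)
  have hzU : z ∈ U := (U.mul_mem_cancel_left (hWU hy)).1 hx
  rw [plus_eq_of_le hUW hWU]
  exact Set.mul_mem_mul hy (le_minus_of_map_le inf_le_left hinv ⟨hzU, hz⟩)

theorem coe_minusN (n : ℕ) :
    (minusN α U n : Set G) = ⋂ k ∈ Set.Iic n, α^[k] ⁻¹' (U : Set G) := by
  ext x
  simp [mem_minusN]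

theorem isClosed_minusN (hU : IsClosed (U : Set G)) (n : ℕ) :
    IsClosed (minusN α U n : Set G) := by
  rw [coe_minusN]
  exact isClosed_biInter fun k _ => hU.preimage (α.continuous_toFun.iterate k)

theorem isOpen_minusN (hU : IsOpen (U : Set G)) (n : ℕ) : IsOpen (minusN α U n : Set G) := by
  rw [coe_minusN]
  exact (Set.finite_Iic n).isOpen_biInter fun k _ => hU.preimage (α.continuous_toFun.iterate k)

theorem isClosed_minus (hU : IsClosed (U : Set G)) : IsClosed (minus α U : Set G) := by
  rw [minus, Subgroup.coe_iInf]
  exact isClosed_iInter (isClosed_minusN hU)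

theorem isOpen_subgroupOf_minusN (hH : H.map (α : G →* G) ≤ H)
    (hV : IsOpen (V.subgroupOf H : Set H)) (n : ℕ) :
    IsOpen ((minusN α V n).subgroupOf H : Set H) := by
  have hpre : ((minusN α V n).subgroupOf H : Set H) = ⋂ k ∈ Set.Iic n,
      (fun x : H => (⟨α^[k] x, iterate_mem_of_map_le hH x.2 k⟩ : H)) ⁻¹' (V.subgroupOf H) := by
    ext x
    simp [Subgroup.mem_subgroupOf, mem_minusN]
  rw [hpre]
  exact (Set.finite_Iic n).isOpen_biInter fun k _ => hV.preimage
    (((α.continuous_toFun.iterate k).comp continuous_subtype_val).subtype_mk _)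

section Compact

variable [T2Space G]

theorem isCompact_minus (hU : IsCompact (U : Set G)) : IsCompact (minus α U : Set G) :=
  hU.of_isClosed_subset (isClosed_minus hU.isClosed) minus_le

theorem isCompact_map_iter_minus (hU : IsCompact (U : Set G)) (n : ℕ) :
    IsCompact ((minus α U).map (iter α n) : Set G) := by
  rw [Subgroup.coe_map, funext (iter_apply α n)]
  exact (isCompact_minus hU).image (α.continuous_toFun.iterate n)

theorem iInf_map_iter_minus_le (hU : IsCompact (U : Set G)) :
    ⨅ n, (minus α U).map (iter α n) ≤ plus α U ⊓ minus α U := by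
  have hle_minus : ⨅ n, (minus α U).map (iter α n) ≤ minus α U :=
    (iInf_le _ 0).trans (map_iter_zero _).le
  refine le_inf (le_plus_of_le_map (hle_minus.trans minus_le) fun x hx => ?_) hle_minus
  let fiber : ℕ → Set G := fun n => (minus α U).map (iter α n) ∩ α ⁻¹' {x}
  have hfiber_nonempty (n : ℕ) : (fiber n).Nonempty := by
    obtain ⟨y, hy, hyx⟩ := map_iter_succ' (α := α) _ n ▸ Subgroup.mem_iInf.1 hx (n + 1)
    exact ⟨y, hy, hyx⟩
  have hfiber_compact (n : ℕ) : IsCompact (fiber n) :=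
    (isCompact_map_iter_minus hU n).inter_right (isClosed_singleton.preimage α.continuous_toFun)
  obtain ⟨y, hy⟩ := IsCompact.nonempty_iInter_of_sequence_nonempty_isCompact_isClosed fiber
    (fun n => Set.inter_subset_inter_left _ (antitone_map_iter_minus n.le_succ)) hfiber_nonempty
    (hfiber_compact 0) fun n => (hfiber_compact n).isClosed
  rw [Set.mem_iInter] at hy
  exact ⟨y, Subgroup.mem_iInf.2 fun n => (hy n).1, (hy 0).2⟩

theorem exists_map_iter_minus_subset (hU : IsCompact (U : Set G)) {O : Set G} (hO : IsOpen O)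
    (hUO : (plus α U ∩ minus α U : Set G) ⊆ O) :
    ∃ n, ((minus α U).map (iter α n) : Set G) ⊆ O := by
  refine exists_subset_nhds_of_isCompact' antitone_map_iter_minus.directed_ge
    (isCompact_map_iter_minus hU) (fun n => (isCompact_map_iter_minus hU n).isClosed) fun x hx => ?_
  rw [← Subgroup.coe_iInf] at hx
  exact hO.mem_nhds (hUO (iInf_map_iter_minus_le hU hx))

theorem exists_map_iter_minus_le (hW : IsCompact (W : Set G))
    (hV : IsOpen (V.subgroupOf (minus α W) : Set (minus α W))) (hWV : plus α W ⊓ minus α W ≤ V) :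
    ∃ n, (minus α W).map (iter α n) ≤ V := by
  obtain ⟨O, hO, hOV⟩ := isOpen_induced_iff.1 hV
  have hmem (x : minus α W) : (x : G) ∈ O ↔ (x : G) ∈ V := Set.ext_iff.1 hOV x
  obtain ⟨n, hn⟩ := exists_map_iter_minus_subset hW hO fun x hx => (hmem ⟨x, hx.2⟩).2 (hWV hx)
  refine ⟨n, fun x hx => ?_⟩
  have hx_minus : x ∈ minus α W := 
    (map_iter_zero _).le (antitone_map_iter_minus n.zero_le hx)
  exact (hmem ⟨x, hx_minus⟩).1 (hn hx)

theorem isOpen_subgroupOf_minus (hW : IsCompact (W : Set G)) (hVW : V ≤ minus α W)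
    (hV : IsOpen (V.subgroupOf (minus α W) : Set (minus α W))) (hWV : plus α W ⊓ minus α W ≤ V) :
    IsOpen ((minus α V).subgroupOf (minus α W) : Set (minus α W)) := by
  obtain ⟨n, hn⟩ := exists_map_iter_minus_le hW hV hWV
  have hminus : minus α V = minusN α V n := by
    refine (minus_le_minusN n).antisymm fun x hx => mem_minus.2 fun k => ?_
    rcases le_total k n with hk | hk
    · exact mem_minusN.1 hx k hk
    · exact hn (antitone_map_iter_minus hk ⟨x, hVW (minusN_le n hx), iter_apply α k x⟩)
  rw [hminus]
  exact isOpen_subgroupOf_minusN map_minus_le hV n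

end Compact

/-- The subgroup `Ŵ` of part 2: the left stabilizer of `W₊V₋`, taken because the product set itself
need not be a subgroup. -/
def refinement (α : G →ₜ* G) (W V : Subgroup G) : Subgroup G :=
  MulAction.stabilizer G ((plus α W : Set G) * (minus α V : Set G))

theorem plus_le_refinement : plus α W ≤ refinement α W V := fun x hx =>
  MulAction.mem_stabilizer_iff.2 (by rw [← smul_mul_assoc, smul_coe_set hx])

theorem refinement_subset :
    (refinement α W V : Set G) ⊆ (plus α W : Set G) * (minus α V : Set G) :=
  stabilizer_subset_of_one_mem ⟨1, one_mem _, 1, one_mem _, mul_one 1⟩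

theorem refinement_le (hVW : V ≤ W) : refinement α W V ≤ W := fun x hx => by
  obtain ⟨w, hw, v, hv, rfl⟩ := refinement_subset hx
  exact W.mul_mem (plus_le hw) (hVW (minus_le hv))

theorem refinement_inf_minus_le (hVW : V ≤ minus α W) (hWV : plus α W ⊓ minus α W ≤ V) :
    refinement α W V ⊓ minus α W ≤ V := by
  rintro x ⟨hx, hx_minus⟩
  obtain ⟨w, hw, v, hv, rfl⟩ := refinement_subset hx
  have hw_minus : w ∈ minus α W :=
    ((minus α W).mul_mem_cancel_right (hVW (minus_le hv))).1 hx_minus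
  exact V.mul_mem (hWV ⟨hw, hw_minus⟩) (minus_le hv)

theorem map_mem_plus_mul_minus (hVW : V ≤ W) {x : G}
    (hx : x ∈ (plus α W : Set G) * (minus α V : Set G)) (hxW : α x ∈ W) :
    α x ∈ (plus α W : Set G) * (minus α V : Set G) := by
  obtain ⟨w, hw, v, hv, rfl⟩ := hx
  rw [map_mul] at hxW ⊢
  have hαv := map_mem_minus hv
  exact Set.mul_mem_mul
    (map_mem_plus hw ((W.mul_mem_cancel_right (hVW (minus_le hαv))).1 hxW)) hαv

theorem map_smul_plus_mul_minus_subset (hVW : V ≤ W) {x : G} (hxW : α x ∈ W)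
    (hx : x • ((plus α W : Set G) * (minus α V : Set G)) ⊆
      (plus α W : Set G) * (minus α V : Set G)) :
    α x • ((plus α W : Set G) * (minus α V : Set G)) ⊆
      (plus α W : Set G) * (minus α V : Set G) := by
  rintro _ ⟨_, ⟨w, hw, v, hv, rfl⟩, rfl⟩
  obtain ⟨y, hy, rfl⟩ := plus_le_map_plus hw
  have hxy : x * y ∈ (plus α W : Set G) * (minus α V : Set G) :=
    hx ⟨y, ⟨y, hy, 1, one_mem _, mul_one y⟩, rfl⟩
  have hαxy : α (x * y) ∈ W := by
    rw [map_mul]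
    exact W.mul_mem hxW (plus_le hw)
  obtain ⟨w', hw', v', hv', h : w' * v' = α (x * y)⟩ := map_mem_plus_mul_minus hVW hxy hαxy
  refine ⟨w', hw', v' * v, mul_mem hv' hv, ?_⟩
  change w' * (v' * v) = α x * (α y * v)
  rw [← mul_assoc, h, map_mul, mul_assoc]

theorem map_refinement_inf_minus_le (hVW : V ≤ W) :
    (refinement α W V ⊓ minus α W).map (α : G →* G) ≤ refinement α W V := by
  rintro _ ⟨x, ⟨hx, hx_minus⟩, rfl⟩
  have hαx : α x ∈ W := minus_le (map_mem_minus hx_minus)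
  obtain ⟨hxS, hxS'⟩ := mem_stabilizer_iff_smul_subset.1 hx
  refine mem_stabilizer_iff_smul_subset.2 ⟨map_smul_plus_mul_minus_subset hVW hαx hxS, ?_⟩
  rw [← map_inv]
  exact map_smul_plus_mul_minus_subset hVW (map_inv α x ▸ W.inv_mem hαx) hxS'

variable [IsTopologicalGroup G]

theorem isClosed_plus [T2Space G] (hU : IsCompact (U : Set G)) :
    IsClosed (plus α U : Set G) := by
  have hclosure : (plus α U).topologicalClosure ≤ U :=
    (plus α U).topologicalClosure_minimal plus_le hU.isClosed
  have hcompact : IsCompact ((plus α U).topologicalClosure : Set G) :=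
    hU.of_isClosed_subset (plus α U).isClosed_topologicalClosure hclosure
  refine isClosed_of_closure_subset (le_plus_of_le_map (α := α) hclosure ?_)
  refine (plus α U).topologicalClosure_minimal ?_ (hcompact.image α.continuous_toFun).isClosed
  exact plus_le_map_plus.trans (Subgroup.map_mono (plus α U).le_topologicalClosure)

theorem isCompact_plus [T2Space G] (hU : IsCompact (U : Set G)) : IsCompact (plus α U : Set G) :=
  hU.of_isClosed_subset (isClosed_plus hU) plus_le

theorem IsTidy.minusN (h : IsTidy α U) (n : ℕ) : IsTidy α (minusN α U n) where
  isCompact := h.isCompact.of_isClosed_subset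
    (isClosed_minusN (U.isClosed_of_isOpen h.isOpen) n) (minusN_le n)
  isOpen := isOpen_minusN h.isOpen n
  tidyAbove := h.tidyAbove.minusN n
  tidyBelow := h.tidyBelow.minusN n

theorem IsTidy.isOpen_refinement [T2Space G] (hW : IsTidy α W) (hVW : V ≤ minus α W)
    (hV : IsOpen (V.subgroupOf (minus α W) : Set (minus α W))) (hWV : plus α W ⊓ minus α W ≤ V) :
    IsOpen (refinement α W V : Set G) := by
  have hle : minus α V ≤ minus α W := minus_le.trans hVW
  have hplus : IsCompact (plus α W : Set G) := isCompact_plus hW.isCompact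
  have hminus : IsCompact (minus α W : Set G) := isCompact_minus hW.isCompact
  have hrel := isOpen_subgroupOf_minus hW.isCompact hVW hV hWV
  refine isOpen_stabilizer (hplus.mul (isCompact_of_isOpen_subgroupOf hminus hle hrel)) ?_
  exact isOpen_mul_of_isOpen_subgroupOf hplus hminus (hW.tidyAbove ▸ hW.isOpen) hle hrel
    (le_minus_of_map_le hWV map_plus_inf_minus_le)

theorem IsTidy.refinement [T2Space G] (hW : IsTidy α W) (hVW : V ≤ minus α W)
    (hV : IsOpen (V.subgroupOf (minus α W) : Set (minus α W))) (hWV : plus α W ⊓ minus α W ≤ V) :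
    IsTidy α (refinement α W V) where
  isCompact := hW.isCompact.of_isClosed_subset
    (Subgroup.isClosed_of_isOpen _ (hW.isOpen_refinement hVW hV hWV))
    (refinement_le (hVW.trans minus_le))
  isOpen := hW.isOpen_refinement hVW hV hWV
  tidyAbove := hW.tidyAbove.of_plus_le (refinement_le (hVW.trans minus_le)) plus_le_refinement
    (map_refinement_inf_minus_le (hVW.trans minus_le))
  tidyBelow := hW.tidyBelow.of_plus_eq
    (plus_eq_of_le (refinement_le (hVW.trans minus_le)) plus_le_refinement)

theorem IsTidy.plus_inf_minus_eq_sInf [TotallyDisconnectedSpace G] (hW : IsTidy α W) :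
    plus α W ⊓ minus α W =
      sInf {W' : Subgroup G | plus α W ⊓ minus α W ≤ W' ∧ W' ≤ W ∧ IsTidy α W'} := by
  refine le_antisymm (le_sInf fun W' hW' => hW'.1) fun x hx => ?_
  rw [Subgroup.mem_sInf] at hx
  have hx_minus : x ∈ minus α W := Subgroup.mem_iInf.2 fun n =>
    hx _ ⟨inf_le_right.trans (minus_le_minusN n), minusN_le n, hW.minusN n⟩
  refine ⟨mem_of_forall_isOpen_subgroupOf (isCompact_minus hW.isCompact)
    (isClosed_plus hW.isCompact) hx_minus fun V hVW hV hWV => ?_, hx_minus⟩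
  exact refinement_inf_minus_le hVW hWV ⟨hx _ ⟨inf_le_left.trans plus_le_refinement,
    refinement_le (hVW.trans minus_le), hW.refinement hVW hV hWV⟩, hx_minus⟩

end TidyEndo

theorem mainTheorem10 {G : Type*} [Group G] [TopologicalSpace G] [IsTopologicalGroup G]
    [LocallyCompactSpace G] [TotallyDisconnectedSpace G]
    (α : G →ₜ* G) (W : Subgroup G) (hW : TidyEndo.IsTidy α W) :
    (∀ n : ℕ, TidyEndo.IsTidy α (TidyEndo.minusN α W n)) ∧
    (∀ V : Subgroup G, V ≤ TidyEndo.minus α W →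
      IsOpen (V.subgroupOf (TidyEndo.minus α W) : Set (TidyEndo.minus α W)) →
      TidyEndo.plus α W ⊓ TidyEndo.minus α W ≤ V →
      ∃ W' : Subgroup G, W' ≤ W ∧ IsOpen (W' : Set G) ∧ TidyEndo.IsTidy α W' ∧
        TidyEndo.plus α W ≤ W' ∧ W' ⊓ TidyEndo.minus α W ≤ V) ∧
    TidyEndo.plus α W ⊓ TidyEndo.minus α W =
      sInf {W' : Subgroup G | TidyEndo.plus α W ⊓ TidyEndo.minus α W ≤ W' ∧ W' ≤ W ∧
        TidyEndo.IsTidy α W'} :=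
  ⟨hW.minusN,
    fun V hVW hV hWV => ⟨TidyEndo.refinement α W V,
      TidyEndo.refinement_le (hVW.trans TidyEndo.minus_le), hW.isOpen_refinement hVW hV hWV,
      hW.refinement hVW hV hWV, TidyEndo.plus_le_refinement,
      TidyEndo.refinement_inf_minus_le hVW hWV⟩,
    hW.plus_inf_minus_eq_sInf⟩
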